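/- Let $X$ be a nonempty finite totally ordered alphabet, $X^*$ the set of words over $X$, $X^+$ the set of nonempty words, $|\eta|$ the length of a word $\eta$, and $\emptyset$ the empty word. A word $\eta\in X^+$ is a Lyndon word if $\eta<\nu\xi$ in the lexicographic order for every factorization $\eta=\xi\nu$ with $\xi,\nu\in X^+$. Let $L$ be the set of Lyndon words; for $l\in L$ write $(l)$ for $l$ viewed as an element of $X^+$. Let $L^+$ be the set of nontrivial commutative monomials $l_{i_1}\cdots l_{i_n}$ ($n\ge 1$) in the elements of $L$, and put $|l_{i_1}\cdots l_{i_n}|=|(l_{i_1})|+\cdots+|(l_{i_n})|$. Let $\mathbb{R}_p\langle X\rangle$ and $\mathbb{R}_p\langle\langle X\rangle\rangle$ be the real vector spaces of noncommutative polynomials and formal power series over $X$ that are proper (zero coefficient at $\emptyset$), and let $\mathbb{R}[L]$ and $\mathbb{R}[[L]]$ denote the real vector spaces of commutative polynomials and formal power series in the variables $L$ without constant term; all are graded by $|\cdot|$, in degrees $k>0$. Write $(c,\eta)$ for the coefficient of $c$ at $\eta$. Let $\sqcup\!\sqcup$ be the shuffle product. Theorem. There is exactly one $\mathbb{R}$-linear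 map $\mathscr{L}:\mathbb{R}_p\langle X\rangle\to\mathbb{R}[L]$ such that $\mathscr{L}(\eta_1\sqcup\!\sqcup\,\eta_2)=\mathscr{L}(\eta_1)\mathscr{L}(\eta_2)$ for all $\eta_1,\eta_2\in X^+$ and $\mathscr{L}((l))=l$ for all $l\in L$, and it is bijective. For all $\eta\in X^+$ and $l\in L^+$ one has $(\mathscr{L}(\eta),l)=0=(\mathscr{L}^{-1}(l),\eta)$ whenever $|\eta|\ne|l|$ (block diagonality); for each $l\in L^+$ only finitely many $\eta$ satisfy $(\mathscr{L}(\eta),l)\neq 0$, and for each $\eta\in X^+$ only finitely many $l$ satisfy $(\mathscr{L}^{-1}(l),\eta)\ne 0$ (local finiteness). Moreover $\mathscr{L}$ extends to an $\mathbb{R}$-linear isomorphism $\mathscr{L}:\mathbb{R}_p\langle\langle X\rangle\rangle\to\mathbb{R}[[L]]$ which is given, together with its inverse, by the finite sums $$(\mathscr{L}(c),l)=\sum_{\eta\in X^+}(c,\eta)\,(\mathscr{L}(\eta),l),\qquad (\mathscr{L}^{-1}(f),\eta)=\sum_{l\in L^+}(f,l)\,(\mathscr{L}^{-1}(l),\eta)$$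 for $c\in\mathbb{R}_p\langle\langle X\rangle\rangle$, $f\in\mathbb{R}[[L]]$, $l\in L^+$, $\eta\in X^+$. This isomorphism is graded: for every $k>0$ it maps the homogeneous component of degree $k$ of $\mathbb{R}_p\langle\langle X\rangle\rangle$ onto that of $\mathbb{R}[[L]]$, and it commutes with taking the homogeneous part of degree $k$ of a series. -/

import Mathlib

namespace LyndonTransduction

noncomputable section

/-- The set `X⁺` of nonempty words over the alphabet `X`. -/
abbrev NEWord (X : Type*) := {w : List X // w ≠ []}

/-- A Lyndon word: a nonempty word which is strictly smaller, in the lexicographic order, than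
`ν ξ` for each of its factorizations `ξ ν` into two nonempty words. -/
def IsLyndon {X : Type*} [LinearOrder X] (w : List X) : Prop :=
  w ≠ [] ∧ ∀ u v : List X, u ≠ [] → v ≠ [] → w = u ++ v → w < v ++ u

/-- The set `L` of Lyndon words over `X`; its elements serve as commuting variables. -/
abbrev Lyndon (X : Type*) [LinearOrder X] := {w : List X // IsLyndon w}

/-- The set `L⁺` of nontrivial commutative monomials in the Lyndon words. -/
abbrev LyndonMonomial (X : Type*) [LinearOrder X] := {m : Lyndon X →₀ ℕ // m ≠ 0}

/-- The degree of a monomial `l₁ ⋯ lₙ`, namely `|l₁| + ⋯ + |lₙ|`. -/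
def monomialDegree {X : Type*} [LinearOrder X] (m : Lyndon X →₀ ℕ) : ℕ :=
  Finsupp.weight (fun l : Lyndon X => l.1.length) m

/-! ### Noncommutative polynomials and the shuffle product -/

/-- The shuffle product of two words, as a noncommutative polynomial with real coefficients. -/
def shuffleWords {X : Type*} : List X → List X → (List X →₀ ℝ)
  | [], v => Finsupp.single v 1
  | a :: u, [] => Finsupp.single (a :: u) 1
  | a :: u, b :: v =>
      (shuffleWords u (b :: v)).mapDomain (List.cons a) +
        (shuffleWords (a :: u) v).mapDomain (List.cons b)
termination_by u v => u.length + v.length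

/-- The subspace of proper polynomials (zero coefficient at the empty word). -/
def properPoly (X : Type*) : Submodule ℝ (List X →₀ ℝ) :=
  LinearMap.ker (Finsupp.lapply [])

/-- The subspace of proper formal power series `c : X* → ℝ`. -/
def properSeries (X : Type*) : Submodule ℝ (List X → ℝ) :=
  LinearMap.ker (LinearMap.proj [])

/-- The commutative polynomials in the Lyndon words without constant term. -/
def lyndonPoly (X : Type*) [LinearOrder X] : Submodule ℝ (MvPolynomial (Lyndon X) ℝ) :=
  LinearMap.ker (MvPolynomial.lcoeff ℝ 0)

/-- The commutative formal power series in the Lyndon words without constant term. -/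
def lyndonSeries (X : Type*) [LinearOrder X] : Submodule ℝ (MvPowerSeries (Lyndon X) ℝ) :=
  LinearMap.ker (MvPowerSeries.coeff 0)

/-- A nonempty word as a proper polynomial. -/
def word {X : Type*} (w : NEWord X) : properPoly X :=
  ⟨Finsupp.single w.1 1, by
    simp [properPoly, w.2]⟩

theorem shuffleWords_nil {X : Type*} (u v : List X) (hu : u ≠ []) : shuffleWords u v [] = 0 := by
  match u, v, hu with
  | a :: u, [], _ => simp [shuffleWords]
  | a :: u, b :: v, _ =>
    rw [shuffleWords, Finsupp.add_apply, Finsupp.mapDomain_of_notMem_range _ _ (by simp),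
      Finsupp.mapDomain_of_notMem_range _ _ (by simp), add_zero]

/-- The shuffle product of two nonempty words, as a proper polynomial. -/
def shuffle {X : Type*} (u v : NEWord X) : properPoly X :=
  ⟨shuffleWords u.1 v.1, shuffleWords_nil u.1 v.1 u.2⟩

/-- A Lyndon word `(l)`, seen as a nonempty word. -/
def Lyndon.toWord {X : Type*} [LinearOrder X] (l : Lyndon X) : NEWord X := ⟨l.1, l.2.1⟩

/-- A nontrivial Lyndon monomial, as a polynomial without constant term. -/
def mono {X : Type*} [LinearOrder X] (m : LyndonMonomial X) : lyndonPoly X :=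
  ⟨MvPolynomial.monomial m.1 1, by
    simp [lyndonPoly, MvPolynomial.lcoeff, MvPolynomial.coeff_monomial, m.2]⟩

/-- The inclusion of proper polynomials into proper series. -/
def polyToSeries {X : Type*} (p : properPoly X) : properSeries X := ⟨⇑p.1, p.2⟩

/-- The inclusion of polynomials in the Lyndon words into series in the Lyndon words. -/
def lyndonPolyToSeries {X : Type*} [LinearOrder X] (q : lyndonPoly X) : lyndonSeries X :=
  ⟨(q.1 : MvPowerSeries (Lyndon X) ℝ), by
    have h : MvPolynomial.coeff 0 q.1 = 0 := q.2
    simpa [lyndonSeries] using h⟩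

/-- The defining properties of the map `ℒ` on proper polynomials: it turns shuffle products of
words into commutative products, and it sends the word `(l)` to the variable `l` for each Lyndon
word `l`. -/
structure IsLyndonMap {X : Type*} [LinearOrder X] (T : properPoly X →ₗ[ℝ] lyndonPoly X) :
    Prop where
  map_shuffle : ∀ u v : NEWord X,
    (T (shuffle u v) : MvPolynomial (Lyndon X) ℝ) = T (word u) * T (word v)
  map_lyndon : ∀ l : Lyndon X,
    (T (word l.toWord) : MvPolynomial (Lyndon X) ℝ) = MvPolynomial.X l

/-! ### Gradings by word length -/

/-- The proper series supported on words of length `k`. -/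
def seriesComponent (X : Type*) (k : ℕ) : Submodule ℝ (properSeries X) where
  carrier := {c | ∀ w : List X, w.length ≠ k → c.1 w = 0}
  zero_mem' := fun _ _ => rfl
  add_mem' := fun {a b} ha hb w hw => by
    simp [ha w hw, hb w hw]
  smul_mem' := fun r a ha w hw => by
    simp [ha w hw]

/-- The series in the Lyndon words supported on monomials of degree `k`. -/
def lyndonComponent (X : Type*) [LinearOrder X] (k : ℕ) : Submodule ℝ (lyndonSeries X) where
  carrier := {f | f.1.IsWeightedHomogeneous (fun l : Lyndon X => l.1.length) k}
  zero_mem' := fun h => absurd rfl h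
  add_mem' := fun ha hb => ha.add hb
  smul_mem' := fun r a ha m hm => by
    by_contra h
    exact hm (by simp [ha.coeff_eq_zero h])

/-- The homogeneous part of length `k` of a proper series. -/
def seriesPart {X : Type*} (k : ℕ) (c : properSeries X) : properSeries X :=
  ⟨fun w => if w.length = k then c.1 w else 0, by
    have h : c.1 [] = 0 := c.2
    simp [properSeries, h]⟩

/-- The homogeneous part of degree `k` of a series in the Lyndon words. -/
def lyndonPart {X : Type*} [LinearOrder X] (k : ℕ) (f : lyndonSeries X) : lyndonSeries X :=
  ⟨MvPowerSeries.weightedHomogeneousComponent (fun l : Lyndon X => l.1.length) k f.1, by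
    have h : MvPowerSeries.coeff 0 f.1 = 0 := f.2
    change MvPowerSeries.coeff 0 _ = 0
    rw [MvPowerSeries.coeff_weightedHomogeneousComponent, h, ite_self]⟩

end

end LyndonTransduction

open LyndonTransduction

/-! The inverse of the map is the algebra homomorphism `shuffleEval`, which evaluates a commutative
polynomial in the shuffle algebra by sending each variable to its Lyndon word. That this is an
isomorphism is Radford's theorem, proved here by triangularity.

By the Chen–Fox–Lyndon theorem, concatenating the Lyndon words of a monomial in nonincreasing order
(`leadingWord`) is a bijection from monomials to words that turns degree into length. The shuffle
product of those Lyndon words contains this word with positive coefficient, and every other word in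
it has the same length and is lexicographically smaller (`shuffleEval_monomial_spec`). The bound
rests on `append_sortedConcat_le_lyndonCons` and `IsShuffle.le_sortedConcat`: no shuffle of `u` and
`v` exceeds the nonincreasing concatenation of all their Lyndon factors. Coefficients are
nonnegative, so nothing cancels and no multiplicity has to be computed.

Since the isomorphism preserves degree and each degree involves finitely many words and monomials,
it extends to series degree by degree. For uniqueness, any admissible map, extended by `1 ↦ 1`, is
an algebra homomorphism left inverse to the surjection `shuffleEval`. -/

namespace LyndonTransduction

/-! ### Lexicographic comparison of words -/

section Lex

variable {X : Type*} [LinearOrder X]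

/-- `u` is lexicographically smaller than `v` because of a letter at which they differ. -/
inductive DiffersLT : List X → List X → Prop
  | head {a b : X} (u v : List X) (h : a < b) : DiffersLT (a :: u) (b :: v)
  | cons (a : X) {u v : List X} (h : DiffersLT u v) : DiffersLT (a :: u) (a :: v)

/-- A strict inequality decided at a letter survives arbitrary continuations; one due to a proper
prefix need not, hence the separate relation. -/
theorem DiffersLT.append {u v : List X} (h : DiffersLT u v) (s t : List X) :
    DiffersLT (u ++ s) (v ++ t) := by
  induction h with
  | head u v h => exact .head _ _ h
  | cons a _ ih => exact .cons a ih

theorem DiffersLT.lt {u v : List X} (h : DiffersLT u v) : u < v := by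
  induction h with
  | head u v h => exact List.Lex.rel h
  | cons a _ ih => exact List.Lex.cons ih

theorem differsLT_or_prefix_of_lt {u v : List X} (h : u < v) :
    DiffersLT u v ∨ ∃ t, t ≠ [] ∧ v = u ++ t := by
  replace h : List.Lex (· < ·) u v := h
  induction h with
  | nil => exact .inr ⟨_, List.cons_ne_nil _ _, rfl⟩
  | rel h => exact .inl (.head _ _ h)
  | cons _ ih =>
    rcases ih with ih | ⟨t, ht, rfl⟩
    · exact .inl (.cons _ ih)
    · exact .inr ⟨t, ht, rfl⟩

theorem differsLT_of_lt_of_length_le {u v : List X} (h : u < v) (hl : v.length ≤ u.length) :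
    DiffersLT u v := by
  rcases differsLT_or_prefix_of_lt h with h | ⟨t, ht, rfl⟩
  · exact h
  · have := List.length_pos_iff.2 ht
    simp only [List.length_append] at hl
    omega

theorem append_lt_append_left (s : List X) {u v : List X} (h : u < v) : s ++ u < s ++ v :=
  List.Lex.append_left _ h s

theorem append_le_append_left (s : List X) {u v : List X} (h : u ≤ v) : s ++ u ≤ s ++ v := by
  rcases h.eq_or_lt with rfl | h
  · exact le_rfl
  · exact (append_lt_append_left s h).le

theorem cons_le_cons (a : X) {u v : List X} (h : u ≤ v) : a :: u ≤ a :: v :=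
  append_le_append_left [a] h

theorem le_append (u v : List X) : u ≤ u ++ v := by
  have h : [] ≤ v := not_lt.1 (List.not_lt_nil v)
  simpa using append_le_append_left u h

end Lex

/-! ### Lyndon words and their concatenation -/

section LyndonWords

variable {X : Type*} [LinearOrder X]

/-- If `v < w` is decided at a letter, then `v ++ u < w`, against the definition. Otherwise `w = v
++ t`; comparing with the rotation `v ++ u` gives `t < u` with equal lengths, so the rotation `t ++
v` lies below `u ++ v = w`. -/
theorem IsLyndon.lt_suffix {w u v : List X} (h : IsLyndon w) (hu : u ≠ []) (hv : v ≠ [])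
    (hw : w = u ++ v) : w < v := by
  by_contra! hle
  have hlt := h.2 u v hu hv hw
  rcases hle.eq_or_lt with heq | hlt'
  · exact hu (List.append_left_eq_self.1 (hw.symm.trans heq.symm))
  · rcases differsLT_or_prefix_of_lt hlt' with hd | ⟨t, ht, rfl⟩
    · have := (hd.append u []).lt
      rw [List.append_nil] at this
      exact lt_asymm hlt this
    · have h1 : t < u := by
        by_contra! hc
        exact absurd hlt (append_le_append_left v hc).not_gt
      have hl : u.length = t.length := by
        have := congrArg List.length hw
        simp at this
        omega
      have h2 := ((differsLT_of_lt_of_length_le h1 hl.le).append v v).lt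
      have h3 := h.2 v t hv ht rfl
      rw [hw] at h3
      exact lt_asymm h2 h3

theorem isLyndon_of_lt_suffix {w : List X} (hw : w ≠ [])
    (h : ∀ u v, u ≠ [] → v ≠ [] → w = u ++ v → w < v) : IsLyndon w := by
  refine ⟨hw, fun u v hu hv huv => ?_⟩
  have hl : v.length ≤ w.length := by simp [huv]
  have := ((differsLT_of_lt_of_length_le (h u v hu hv huv) hl).append [] u).lt
  rwa [List.append_nil] at this

theorem isLyndon_singleton (a : X) : IsLyndon [a] := by
  refine ⟨by simp, fun u v hu hv h => ?_⟩
  have := congrArg List.length h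
  have := List.length_pos_iff.2 hu
  have := List.length_pos_iff.2 hv
  simp at *
  omega

theorem IsLyndon.append_lt_right {x y : List X} (hx : IsLyndon x) (hy : IsLyndon y)
    (hxy : x < y) : x ++ y < y := by
  rcases differsLT_or_prefix_of_lt hxy with hd | ⟨t, ht, rfl⟩
  · simpa using (hd.append y []).lt
  · exact append_lt_append_left x (hy.lt_suffix hx.1 ht rfl)

/-- A proper suffix of `x ++ y` is `y`, a suffix of `y`, or `t ++ y` with `t` a proper suffix of
`x`. The first two exceed `x ++ y` by `append_lt_right`; in the last, `x < t` is decided at a letter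
because `t` is shorter. -/
theorem IsLyndon.append {x y : List X} (hx : IsLyndon x) (hy : IsLyndon y) (hxy : x < y) :
    IsLyndon (x ++ y) := by
  have hy' := hx.append_lt_right hy hxy
  refine isLyndon_of_lt_suffix (by simp [hx.1]) fun u v hu hv huv => ?_
  rcases List.append_eq_append_iff.1 huv with ⟨t, rfl, ht⟩ | ⟨t, ht, rfl⟩
  · rcases eq_or_ne t [] with rfl | ht'
    · simpa [ht] using hy'
    · exact hy'.trans (hy.lt_suffix ht' hv ht)
  · rcases eq_or_ne t [] with rfl | ht'
    · simpa using hy'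
    · have hlt := hx.lt_suffix hu ht' ht
      exact ((differsLT_of_lt_of_length_le hlt (by simp [ht])).append y y).lt

/-! ### The Chen–Fox–Lyndon factorization -/

/-- A sequence of Lyndon words which is nonincreasing, as in the Chen–Fox–Lyndon factorization. -/
structure IsLyndonSequence (ls : List (List X)) : Prop where
  lyndon : ∀ l ∈ ls, IsLyndon l
  pairwise : ls.Pairwise (· ≥ ·)

theorem IsLyndonSequence.tail {l : List X} {ls : List (List X)}
    (h : IsLyndonSequence (l :: ls)) : IsLyndonSequence ls :=
  ⟨fun x hx => h.lyndon x (List.mem_cons_of_mem _ hx), h.pairwise.of_cons⟩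

/-- The prefix `t` ends inside or at the end of some factor; `p` is the part of that factor it
covers, and a prefix is never larger than the whole. -/
theorem exists_suffix_le_of_flatten_eq {ls : List (List X)} {l t r : List X}
    (hl : ∀ m ∈ ls, m ≤ l) (ht : t ≠ []) (h : ls.flatten = t ++ r) :
    ∃ s p, p ≠ [] ∧ t = s ++ p ∧ p ≤ l := by
  induction ls generalizing t with
  | nil => simp_all
  | cons m ms ih =>
    rw [List.flatten_cons] at h
    rcases List.append_eq_append_iff.1 h with ⟨t', rfl, ht'⟩ | ⟨t', rfl, -⟩
    · rcases eq_or_ne t' [] with rfl | hne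
      · exact ⟨[], m, by simpa using ht, by simp, hl m (by simp)⟩
      · obtain ⟨s, p, hp, rfl, hle⟩ := ih (fun x hx => hl x (List.mem_cons_of_mem _ hx)) hne ht'
        exact ⟨m ++ s, p, hp, by simp, hle⟩
    · exact ⟨[], t, ht, rfl, (le_append t t').trans (hl _ (by simp))⟩

/-- A longer Lyndon prefix `l'` would begin with `l` and have a proper suffix `p ≤ l ≤ l'`, although
a Lyndon word is smaller than its proper suffixes. Thus the first factor is the longest Lyndon
prefix, which makes the factorization unique. -/
theorem IsLyndonSequence.length_le_head {l l' r : List X} {ls : List (List X)}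
    (h : IsLyndonSequence (l :: ls)) (hl' : IsLyndon l')
    (heq : (l :: ls).flatten = l' ++ r) : l'.length ≤ l.length := by
  by_contra! hlt
  rw [List.flatten_cons] at heq
  rcases List.append_eq_append_iff.1 heq with ⟨t, rfl, ht⟩ | ⟨t, rfl, -⟩
  · have hne : t ≠ [] := by rintro rfl; simp at hlt
    obtain ⟨s, p, hp, rfl, hle⟩ :=
      exists_suffix_le_of_flatten_eq (fun m hm => List.rel_of_pairwise_cons h.pairwise hm) hne ht
    have h1 := hl'.lt_suffix (u := l ++ s) (v := p)
      (by simp [(h.lyndon l (by simp)).1]) hp (by simp)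
    exact absurd (h1.trans_le hle) (le_append _ _).not_gt
  · simp at hlt

theorem IsLyndonSequence.eq_of_flatten_eq {ls ls' : List (List X)} (h : IsLyndonSequence ls)
    (h' : IsLyndonSequence ls') (heq : ls.flatten = ls'.flatten) : ls = ls' := by
  induction ls generalizing ls' with
  | nil =>
    cases ls' with
    | nil => rfl
    | cons l' ls' => exact absurd heq (by simp [(h'.lyndon l' (by simp)).1])
  | cons l ls ih =>
    cases ls' with
    | nil => exact absurd heq (by simp [(h.lyndon l (by simp)).1])
    | cons l' ls' =>
      have h1 := h.length_le_head (h'.lyndon l' (by simp)) (heq.trans (List.flatten_cons ..))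
      have h2 := h'.length_le_head (h.lyndon l (by simp)) (heq.symm.trans (List.flatten_cons ..))
      rw [List.flatten_cons, List.flatten_cons] at heq
      obtain ⟨rfl, hrest⟩ := List.append_inj heq (le_antisymm h2 h1)
      rw [ih h.tail h'.tail hrest]

/-- Put a Lyndon word in front of a nonincreasing sequence of Lyndon words, merging it with the
following ones as long as it is smaller. -/
def lyndonCons (l : List X) : List (List X) → List (List X)
  | [] => [l]
  | m :: ms => if l < m then lyndonCons (l ++ m) ms else l :: m :: ms

/-- The Chen–Fox–Lyndon factorization of a word. -/
def lyndonFactors : List X → List (List X)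
  | [] => []
  | a :: u => lyndonCons [a] (lyndonFactors u)

theorem flatten_lyndonCons (l : List X) (ms : List (List X)) :
    (lyndonCons l ms).flatten = l ++ ms.flatten := by
  induction ms generalizing l with
  | nil => simp [lyndonCons]
  | cons m ms ih =>
    rw [lyndonCons]
    split_ifs with h
    · simp [ih]
    · simp

theorem IsLyndonSequence.lyndonCons {l : List X} {ms : List (List X)} (hl : IsLyndon l)
    (h : IsLyndonSequence ms) : IsLyndonSequence (lyndonCons l ms) := by
  induction ms generalizing l with
  | nil => exact ⟨by simpa [LyndonTransduction.lyndonCons] using hl, by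
      simp [LyndonTransduction.lyndonCons]⟩
  | cons m ms ih =>
    rw [LyndonTransduction.lyndonCons]
    split_ifs with hlt
    · exact ih (hl.append (h.lyndon m (by simp)) hlt) h.tail
    · refine ⟨?_, List.pairwise_cons.2 ⟨?_, h.pairwise⟩⟩
      · simpa using ⟨hl, by simpa using h.lyndon⟩
      · rintro x hx
        rcases List.mem_cons.1 hx with rfl | hx
        · exact not_lt.1 hlt
        · exact (List.rel_of_pairwise_cons h.pairwise hx).le.trans (not_lt.1 hlt)

theorem isLyndonSequence_lyndonFactors (u : List X) : IsLyndonSequence (lyndonFactors u) := by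
  induction u with
  | nil => exact ⟨by simp [lyndonFactors], by simp [lyndonFactors]⟩
  | cons a u ih => exact ih.lyndonCons (isLyndon_singleton a)

theorem flatten_lyndonFactors (u : List X) : (lyndonFactors u).flatten = u := by
  induction u with
  | nil => rfl
  | cons a u ih => rw [lyndonFactors, flatten_lyndonCons, ih]; rfl

theorem IsLyndonSequence.lyndonFactors_flatten {ls : List (List X)} (h : IsLyndonSequence ls) :
    lyndonFactors ls.flatten = ls :=
  (isLyndonSequence_lyndonFactors _).eq_of_flatten_eq h (flatten_lyndonFactors _)

/-! ### Maximality of nonincreasing concatenations -/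

/-- The concatenation of a multiset of words in nonincreasing order. -/
def sortedConcat (s : Multiset (List X)) : List X := (s.sort (· ≥ ·)).flatten

theorem sortedConcat_cons {x : List X} {s : Multiset (List X)} (h : ∀ y ∈ s, y ≤ x) :
    sortedConcat (x ::ₘ s) = x ++ sortedConcat s := by
  rw [sortedConcat, Multiset.sort_cons (r := (· ≥ ·)) _ _ h, List.flatten_cons, sortedConcat]

theorem sortedConcat_coe {ls : List (List X)} (h : ls.Pairwise (· ≥ ·)) :
    sortedConcat (ls : Multiset (List X)) = ls.flatten := by
  rw [sortedConcat, Multiset.coe_sort, List.mergeSort_eq_self _ (by simpa using h)]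

theorem exists_eq_cons_of_ne_zero {s : Multiset (List X)} (h : s ≠ 0) :
    ∃ x t, s = x ::ₘ t ∧ ∀ y ∈ t, y ≤ x := by
  obtain ⟨x, hx, hmax⟩ := s.toFinset.exists_max_image id (by simpa using h)
  rw [Multiset.mem_toFinset] at hx
  obtain ⟨t, rfl⟩ := Multiset.exists_cons_of_mem hx
  exact ⟨x, t, rfl, fun y hy => hmax y (by simp [hy])⟩

/-- Exchange argument: if the greatest word `y` of `s` exceeds `x`, then `x ++ y` is Lyndon, hence
smaller than its rotation `y ++ x`; move `y` to the front and recurse. -/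
theorem append_sortedConcat_le {x : List X} (hx : IsLyndon x) {s : Multiset (List X)}
    (hs : ∀ y ∈ s, IsLyndon y) : x ++ sortedConcat s ≤ sortedConcat (x ::ₘ s) := by
  induction hn : s.card generalizing s with
  | zero =>
    rw [Multiset.card_eq_zero] at hn
    subst hn
    rw [sortedConcat_cons (by simp)]
  | succ n ih =>
    obtain ⟨y, t, rfl, hy⟩ := exists_eq_cons_of_ne_zero (s := s) (by rintro rfl; simp at hn)
    by_cases hxy : y ≤ x
    · rw [sortedConcat_cons (s := y ::ₘ t)]
      intro z hz
      rcases Multiset.mem_cons.1 hz with rfl | hz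
      · exact hxy
      · exact (hy z hz).trans hxy
    · push Not at hxy
      have hyL : IsLyndon y := hs y (by simp)
      have hrec := ih (s := t) (fun z hz => hs z (by simp [hz])) (by simpa using hn)
      have hswap := (hx.append hyL hxy).2 x y hx.1 hyL.1 rfl
      have hd := differsLT_of_lt_of_length_le hswap (by simp [add_comm])
      rw [Multiset.cons_swap, sortedConcat_cons hy, sortedConcat_cons (x := y) (s := x ::ₘ t)]
      · rw [← List.append_assoc]
        refine (hd.append _ (sortedConcat t)).lt.le.trans ?_
        rw [List.append_assoc]
        exact append_le_append_left y hrec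
      · intro z hz
        rcases Multiset.mem_cons.1 hz with rfl | hz
        · exact hxy.le
        · exact hy z hz

/-- Let `x` be the greatest word of `ms` and `s` together. If `x ≤ l`, nothing merges and equality
holds. If `x` lies in `s`, exchange it with `l`. Otherwise `x` is the head of `ms` and merges with
`l`, so the claim is the one for `l ++ x` and the remaining factors. -/
theorem append_sortedConcat_le_lyndonCons {l : List X} (hl : IsLyndon l) {ms : List (List X)}
    (hms : IsLyndonSequence ms) {s : Multiset (List X)} (hs : ∀ y ∈ s, IsLyndon y) :
    l ++ sortedConcat ((ms : Multiset (List X)) + s) ≤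
      sortedConcat ((lyndonCons l ms : Multiset (List X)) + s) := by
  induction hn : ms.length + s.card generalizing l ms s with
  | zero =>
    obtain rfl : ms = [] := List.length_eq_zero_iff.1 (by omega)
    obtain rfl : s = 0 := Multiset.card_eq_zero.1 (by omega)
    simp [lyndonCons, sortedConcat]
  | succ n ih =>
    by_cases hle : ∀ y ∈ (ms : Multiset (List X)) + s, y ≤ l
    · have : lyndonCons l ms = l :: ms := by
        cases ms with
        | nil => rfl
        | cons m ms => rw [lyndonCons, if_neg (hle m (by simp)).not_gt]
      rw [this, ← Multiset.cons_coe, Multiset.cons_add, sortedConcat_cons hle]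
    · obtain ⟨x, t, hxt, hx⟩ := exists_eq_cons_of_ne_zero (s := (ms : Multiset (List X)) + s)
        (by intro h; rw [h] at hle; simp at hle)
      have hlx : l < x := by
        by_contra! hc
        refine hle fun y hy => ?_
        rw [hxt] at hy
        rcases Multiset.mem_cons.1 hy with rfl | hy
        · exact hc
        · exact (hx y hy).trans hc
      by_cases hxs : x ∈ s
      · obtain ⟨s, rfl⟩ := Multiset.exists_cons_of_mem hxs
        have hxL : IsLyndon x := hs x (by simp)
        have ht : t = ↑ms + s := by
          rw [Multiset.add_cons] at hxt
          exact ((Multiset.cons_inj_right x).1 hxt).symm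
        subst ht
        have hrec := ih hl hms (s := s) (fun z hz => hs z (by simp [hz]))
          (by simp at hn; omega)
        have hswap := (hl.append hxL hlx).2 l x hl.1 hxL.1 rfl
        have hd := differsLT_of_lt_of_length_le hswap (by simp [add_comm])
        rw [hxt, sortedConcat_cons hx, ← List.append_assoc]
        refine (hd.append _ (sortedConcat (↑ms + s))).lt.le.trans ?_
        rw [List.append_assoc, Multiset.add_cons]
        -- `append_sortedConcat_le` puts `x` back in its place without comparing it to the merged
        -- words.
        refine (append_le_append_left x hrec).trans (append_sortedConcat_le hxL ?_)
        intro z hz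
        rcases Multiset.mem_add.1 hz with hz | hz
        · exact (hms.lyndonCons hl).lyndon z (by simpa using hz)
        · exact hs z (by simp [hz])
      · have hxm : x ∈ ms := by
          have : x ∈ (ms : Multiset (List X)) + s := by simp [hxt]
          simpa [hxs] using this
        cases ms with
        | nil => simp at hxm
        | cons m ms =>
          have hmx : m = x := by
            refine le_antisymm ?_ ?_
            · have : m ∈ x ::ₘ t := by rw [← hxt]; simp
              rcases Multiset.mem_cons.1 this with rfl | h
              · exact le_rfl
              · exact hx m h
            · rcases List.mem_cons.1 hxm with rfl | h
              · exact le_rfl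
              · exact List.rel_of_pairwise_cons hms.pairwise h
          subst hmx
          have ht : t = ↑ms + s := by
            rw [← Multiset.cons_coe, Multiset.cons_add] at hxt
            exact ((Multiset.cons_inj_right m).1 hxt).symm
          subst ht
          have hrec := ih (hl.append (hms.lyndon m (by simp)) hlx) hms.tail hs
            (by simp at hn; omega)
          rw [lyndonCons, if_pos hlx, hxt, sortedConcat_cons hx, ← List.append_assoc]
          exact hrec

end LyndonWords

/-! ### Shuffles of words and their upper bound -/

section Shuffles

variable {X : Type*}

/-- `IsShuffle u v z` means that `z` is obtained by interleaving `u` and `v`. -/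
inductive IsShuffle : List X → List X → List X → Prop
  | nil : IsShuffle [] [] []
  | left (a : X) {u v z : List X} (h : IsShuffle u v z) : IsShuffle (a :: u) v (a :: z)
  | right (b : X) {u v z : List X} (h : IsShuffle u v z) : IsShuffle u (b :: v) (b :: z)

theorem IsShuffle.length_eq {u v z : List X} (h : IsShuffle u v z) :
    z.length = u.length + v.length := by
  induction h with
  | nil => rfl
  | left a _ ih => simp [ih]; omega
  | right b _ ih => simp [ih]; omega

theorem isShuffle_nil_left (v : List X) : IsShuffle [] v v := by
  induction v with
  | nil => exact .nil
  | cons b v ih => exact .right b ih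

theorem isShuffle_nil_right (u : List X) : IsShuffle u [] u := by
  induction u with
  | nil => exact .nil
  | cons b v ih => exact .left b ih

theorem IsShuffle.symm {u v z : List X} (h : IsShuffle u v z) : IsShuffle v u z := by
  induction h with
  | nil => exact .nil
  | left a _ ih => exact .right a ih
  | right b _ ih => exact .left b ih

theorem mapDomain_cons_apply_cons (f : List X →₀ ℝ) (a b : X) (w : List X) [Decidable (a = b)] :
    f.mapDomain (List.cons a) (b :: w) = if a = b then f w else 0 := by
  split_ifs with h
  · subst h
    exact Finsupp.mapDomain_apply List.cons_injective f w
  · exact Finsupp.mapDomain_of_notMem_range _ _ (by simp [h])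

theorem shuffleWords_nonneg (u v z : List X) : 0 ≤ shuffleWords u v z := by
  classical
  induction z generalizing u v with
  | nil =>
    match u, v with
    | [], v => rw [shuffleWords, Finsupp.single_apply]; positivity
    | a :: u, v => rw [shuffleWords_nil _ _ (by simp)]
  | cons c z ih =>
    match u, v with
    | [], v => rw [shuffleWords, Finsupp.single_apply]; positivity
    | a :: u, [] => rw [shuffleWords, Finsupp.single_apply]; positivity
    | a :: u, b :: v =>
      rw [shuffleWords, Finsupp.add_apply, mapDomain_cons_apply_cons, mapDomain_cons_apply_cons]
      have := ih u (b :: v)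
      have := ih (a :: u) v
      positivity

theorem isShuffle_of_shuffleWords_ne_zero {u v z : List X} (h : shuffleWords u v z ≠ 0) :
    IsShuffle u v z := by
  classical
  induction z generalizing u v with
  | nil =>
    match u, v with
    | [], v =>
      rw [shuffleWords, Finsupp.single_apply_ne_zero] at h
      rw [← h.1]
      exact .nil
    | a :: u, v => exact absurd (shuffleWords_nil _ _ (by simp)) h
  | cons c z ih =>
    match u, v with
    | [], v =>
      rw [shuffleWords, Finsupp.single_apply_ne_zero] at h
      rw [← h.1]
      exact isShuffle_nil_left _
    | a :: u, [] =>
      rw [shuffleWords, Finsupp.single_apply_ne_zero] at h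
      rw [← h.1]
      exact isShuffle_nil_right _
    | a :: u, b :: v =>
      rw [shuffleWords, Finsupp.add_apply, mapDomain_cons_apply_cons,
        mapDomain_cons_apply_cons] at h
      by_cases h1 : a = c ∧ shuffleWords u (b :: v) z ≠ 0
      · obtain ⟨rfl, h1⟩ := h1
        exact .left _ (ih h1)
      · by_cases h2 : b = c ∧ shuffleWords (a :: u) v z ≠ 0
        · obtain ⟨rfl, h2⟩ := h2
          exact .right _ (ih h2)
        · refine absurd ?_ h
          rw [not_and, not_not] at h1 h2
          split_ifs with h3 h4 h4 <;> simp_all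

theorem shuffleWords_append_pos (u v : List X) : 0 < shuffleWords u v (u ++ v) := by
  classical
  induction u with
  | nil => rw [shuffleWords]; simp
  | cons a u ih =>
    cases v with
    | nil => rw [shuffleWords]; simp
    | cons b v =>
      rw [shuffleWords, List.cons_append, Finsupp.add_apply, mapDomain_cons_apply_cons,
        mapDomain_cons_apply_cons, if_pos rfl]
      have := shuffleWords_nonneg (a :: u) v (u ++ b :: v)
      positivity

variable [LinearOrder X]

/-- Interleave `u'` with `v` in the same pattern up to the first letter where `u'` is larger; from
there any continuation will do. -/
theorem IsShuffle.exists_le {u u' v z : List X} (h : IsShuffle u v z)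
    (hl : u.length = u'.length) (hle : u ≤ u') : ∃ z', IsShuffle u' v z' ∧ z ≤ z' := by
  induction h generalizing u' with
  | nil =>
    obtain rfl : u' = [] := List.length_eq_zero_iff.1 hl.symm
    exact ⟨[], .nil, le_rfl⟩
  | @left a u v z h ih =>
    cases u' with
    | nil => simp at hl
    | cons b u' =>
      have hl' : u.length = u'.length := by simpa using hl
      rcases hle.eq_or_lt with heq | hlt
      · obtain ⟨rfl, rfl⟩ := List.cons.inj heq
        exact ⟨_, .left a h, le_rfl⟩
      · rcases List.cons_lt_cons_iff.1 hlt with hab | ⟨rfl, hlt'⟩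
        · have hsh : IsShuffle (b :: u') v (b :: (u' ++ v)) := by
            clear h ih hl hle hlt hl'
            refine .left b ?_
            induction u' with
            | nil => exact isShuffle_nil_left v
            | cons c u' ih => exact .left c ih
          exact ⟨_, hsh, (DiffersLT.head _ _ hab).lt.le⟩
        · obtain ⟨z', hz', hle'⟩ := ih hl' hlt'.le
          exact ⟨_, .left a hz', cons_le_cons a hle'⟩
  | right b _ ih =>
    obtain ⟨z', hz', hle'⟩ := ih hl hle
    exact ⟨_, .right b hz', cons_le_cons b hle'⟩

/-- Induction on the interleaving: prepending a letter to `u` or `v` inserts it into that word's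
factorization by `lyndonCons`, so each step is `append_sortedConcat_le_lyndonCons` for a single
letter. -/
theorem IsShuffle.le_sortedConcat {u v z : List X} (h : IsShuffle u v z) :
    z ≤ sortedConcat ((lyndonFactors u : Multiset (List X)) + (lyndonFactors v : Multiset _)) := by
  have key : ∀ (a : X) (u v : List X),
      a :: sortedConcat ((lyndonFactors u : Multiset (List X)) + (lyndonFactors v : Multiset _)) ≤
        sortedConcat ((lyndonFactors (a :: u) : Multiset (List X)) +
          (lyndonFactors v : Multiset _)) := fun a u v =>
    append_sortedConcat_le_lyndonCons (isLyndon_singleton a) (isLyndonSequence_lyndonFactors u)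
      (fun y hy => (isLyndonSequence_lyndonFactors v).lyndon y (by simpa using hy))
  induction h with
  | nil => exact not_lt.1 (List.not_lt_nil _)
  | left a _ ih => exact (cons_le_cons a ih).trans (key _ _ _)
  | right b _ ih =>
    rw [add_comm] at ih ⊢
    exact (cons_le_cons b ih).trans (key _ _ _)

end Shuffles

/-! ### The shuffle product as a commutative algebra -/

noncomputable section ShuffleAlgebra

/-- The shuffle algebra: noncommutative polynomials, multiplied by the shuffle product. -/
def ShuffleAlgebra (X : Type*) := List X →₀ ℝ

namespace ShuffleAlgebra

variable {X : Type*}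

instance : AddCommGroup (ShuffleAlgebra X) := inferInstanceAs (AddCommGroup (List X →₀ ℝ))
instance : Module ℝ (ShuffleAlgebra X) := inferInstanceAs (Module ℝ (List X →₀ ℝ))

variable (X) in
/-- The identification of the shuffle algebra with the noncommutative polynomials. -/
def toFinsupp : ShuffleAlgebra X ≃ₗ[ℝ] (List X →₀ ℝ) := LinearEquiv.refl ℝ _

/-- A word as an element of the shuffle algebra. -/
def ofWord (u : List X) : ShuffleAlgebra X := (toFinsupp X).symm (Finsupp.single u 1)

@[simp]
theorem toFinsupp_ofWord (u : List X) : toFinsupp X (ofWord u) = Finsupp.single u 1 := rfl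

/-- Linear maps on the shuffle algebra are determined by their values at words. -/
theorem hom_ext {M : Type*} [AddCommMonoid M] [Module ℝ M] {f g : ShuffleAlgebra X →ₗ[ℝ] M}
    (h : ∀ u, f (ofWord u) = g (ofWord u)) : f = g :=
  Finsupp.lhom_ext' (M := ℝ) fun u => LinearMap.ext_ring (h u)

/-- Prepending a letter. -/
def prepend (a : X) : ShuffleAlgebra X →ₗ[ℝ] ShuffleAlgebra X :=
  (toFinsupp X).symm.toLinearMap ∘ₗ Finsupp.lmapDomain ℝ ℝ (List.cons a) ∘ₗ
    (toFinsupp X).toLinearMap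

theorem prepend_ofWord (a : X) (u : List X) : prepend a (ofWord u) = ofWord (a :: u) :=
  Finsupp.mapDomain_single

/-- The shuffle product of two words. -/
def mulWords (u v : List X) : ShuffleAlgebra X := (toFinsupp X).symm (shuffleWords u v)

/-- The shuffle product as a bilinear map. -/
def mulHom : ShuffleAlgebra X →ₗ[ℝ] ShuffleAlgebra X →ₗ[ℝ] ShuffleAlgebra X :=
  Finsupp.lsum ℝ (fun u => LinearMap.toSpanSingleton ℝ _
    (Finsupp.lsum ℝ (fun v => LinearMap.toSpanSingleton ℝ _ (mulWords u v)) ∘ₗ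
      (toFinsupp X).toLinearMap)) ∘ₗ (toFinsupp X).toLinearMap

instance : Mul (ShuffleAlgebra X) := ⟨fun p q => mulHom p q⟩
instance : One (ShuffleAlgebra X) := ⟨ofWord []⟩

theorem mul_def (p q : ShuffleAlgebra X) : p * q = mulHom p q := rfl
theorem one_def : (1 : ShuffleAlgebra X) = ofWord [] := rfl

theorem ofWord_mul_ofWord (u v : List X) : ofWord u * ofWord v = mulWords u v := by
  simp [mul_def, mulHom]

theorem mulHom_nil_left (p : ShuffleAlgebra X) : mulHom (ofWord []) p = p := by
  refine LinearMap.congr_fun (g := LinearMap.id) (hom_ext fun u => ?_) p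
  rw [← mul_def, ofWord_mul_ofWord, mulWords, shuffleWords]
  rfl

theorem mulWords_comm (u v : List X) : mulWords u v = mulWords v u := by
  suffices h : shuffleWords u v = shuffleWords v u by rw [mulWords, mulWords, h]
  match u, v with
  | [], [] => rfl
  | [], b :: v => rw [shuffleWords, shuffleWords]
  | a :: u, [] => rw [shuffleWords, shuffleWords]
  | a :: u, b :: v =>
    have h1 : shuffleWords u (b :: v) = shuffleWords (b :: v) u := mulWords_comm u (b :: v)
    have h2 : shuffleWords (a :: u) v = shuffleWords v (a :: u) := mulWords_comm (a :: u) v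
    rw [shuffleWords, shuffleWords, h1, h2, add_comm]
termination_by u.length + v.length

theorem mulHom_comm (p q : ShuffleAlgebra X) : mulHom p q = mulHom q p := by
  suffices h : mulHom (X := X) = mulHom.flip from LinearMap.congr_fun (LinearMap.congr_fun h p) q
  refine hom_ext fun u => hom_ext fun v => ?_
  rw [LinearMap.flip_apply, ← mul_def, ← mul_def, ofWord_mul_ofWord, ofWord_mul_ofWord,
    mulWords_comm]

/-- The recursion for words, extended bilinearly: associativity needs it for factors that are
themselves shuffle products. -/
theorem mulHom_prepend (a b : X) (p q : ShuffleAlgebra X) :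
    mulHom (prepend a p) (prepend b q) =
      prepend a (mulHom p (prepend b q)) + prepend b (mulHom (prepend a p) q) := by
  let lhs : ShuffleAlgebra X →ₗ[ℝ] ShuffleAlgebra X →ₗ[ℝ] ShuffleAlgebra X :=
    mulHom.compl₁₂ (prepend a) (prepend b)
  let rhs : ShuffleAlgebra X →ₗ[ℝ] ShuffleAlgebra X →ₗ[ℝ] ShuffleAlgebra X :=
    (mulHom.compl₁₂ LinearMap.id (prepend b)).compr₂ (prepend a) +
      (mulHom.compl₁₂ (prepend a) LinearMap.id).compr₂ (prepend b)
  suffices h : lhs = rhs from LinearMap.congr_fun (LinearMap.congr_fun h p) q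
  refine hom_ext fun u => hom_ext fun v => ?_
  simp only [lhs, rhs, LinearMap.compl₁₂_apply, LinearMap.add_apply, LinearMap.compr₂_apply,
    LinearMap.id_apply, prepend_ofWord, ← mul_def, ofWord_mul_ofWord]
  simp only [mulWords]
  rw [shuffleWords]
  rfl

theorem mulHom_assoc_ofWord (u v w : List X) :
    mulHom (mulHom (ofWord u) (ofWord v)) (ofWord w) =
      mulHom (ofWord u) (mulHom (ofWord v) (ofWord w)) := by
  match u, v, w with
  | [], v, w => rw [mulHom_nil_left, mulHom_nil_left]
  | u, [], w => rw [mulHom_nil_left, mulHom_comm (ofWord u), mulHom_nil_left]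
  | u, v, [] =>
    rw [mulHom_comm _ (ofWord []), mulHom_comm _ (ofWord []), mulHom_nil_left, mulHom_nil_left]
  | a :: u, b :: v, c :: w =>
    have h1 := mulHom_assoc_ofWord u (b :: v) (c :: w)
    have h2 := mulHom_assoc_ofWord (a :: u) v (c :: w)
    have h3 := mulHom_assoc_ofWord (a :: u) (b :: v) w
    -- Both sides expand by the word that supplies the first letter; `h1`, `h2`, `h3` match the
    -- parts beginning with `a`, `b`, `c`.
    simp only [← prepend_ofWord] at h1 h2 h3 ⊢
    rw [mulHom_prepend a b, mulHom_prepend b c]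
    simp only [map_add, LinearMap.add_apply]
    rw [mulHom_prepend a c, mulHom_prepend b c, mulHom_prepend a b, mulHom_prepend a c, h1, h2]
    rw [mulHom_prepend a b] at h3
    simp only [map_add, LinearMap.add_apply] at h3
    rw [mulHom_prepend b c]
    simp only [map_add]
    rw [← h3]
    simp only [map_add]
    abel
termination_by u.length + v.length + w.length

theorem mulHom_assoc (p q r : ShuffleAlgebra X) :
    mulHom (mulHom p q) r = mulHom p (mulHom q r) := by
  let lhs : ShuffleAlgebra X →ₗ[ℝ] ShuffleAlgebra X →ₗ[ℝ] ShuffleAlgebra X →ₗ[ℝ]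
    ShuffleAlgebra X := mulHom.compr₂ mulHom
  let rhs : ShuffleAlgebra X →ₗ[ℝ] ShuffleAlgebra X →ₗ[ℝ] ShuffleAlgebra X →ₗ[ℝ]
    ShuffleAlgebra X :=
      (LinearMap.llcomp ℝ _ _ _).flip mulHom ∘ₗ LinearMap.llcomp ℝ _ _ _ ∘ₗ mulHom
  suffices h : lhs = rhs from
    LinearMap.congr_fun (LinearMap.congr_fun (LinearMap.congr_fun h p) q) r
  refine hom_ext fun u => hom_ext fun v => hom_ext fun w => ?_
  exact mulHom_assoc_ofWord u v w

instance : CommRing (ShuffleAlgebra X) where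
  __ := (inferInstance : AddCommGroup (ShuffleAlgebra X))
  mul_assoc := mulHom_assoc
  mul_comm := mulHom_comm
  one_mul := mulHom_nil_left
  mul_one p := (mulHom_comm _ _).trans (mulHom_nil_left p)
  zero_mul p := by rw [mul_def, map_zero, LinearMap.zero_apply]
  mul_zero p := map_zero (mulHom p)
  left_distrib p q r := map_add (mulHom p) q r
  right_distrib p q r := by simp only [mul_def, map_add, LinearMap.add_apply]

instance : Algebra ℝ (ShuffleAlgebra X) :=
  Algebra.ofModule (fun r p q => by simp only [mul_def, map_smul, LinearMap.smul_apply])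
    (fun r p q => map_smul (mulHom p) r q)

theorem eq_sum (p : ShuffleAlgebra X) :
    p = ∑ u ∈ (toFinsupp X p).support, toFinsupp X p u • ofWord u := by
  apply (toFinsupp X).injective
  rw [map_sum]
  simp_rw [map_smul, toFinsupp_ofWord, Finsupp.smul_single, smul_eq_mul, mul_one]
  exact (Finsupp.sum_single _).symm

theorem ofWord_mul_apply (l z : List X) (p : ShuffleAlgebra X) :
    toFinsupp X (ofWord l * p) z =
      ∑ u ∈ (toFinsupp X p).support, toFinsupp X p u * shuffleWords l u z := by
  conv_lhs => rw [eq_sum p]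
  rw [Finset.mul_sum, map_sum, Finsupp.finsetSum_apply]
  refine Finset.sum_congr rfl fun u _ => ?_
  rw [mul_smul_comm, ofWord_mul_ofWord, map_smul]
  rfl

end ShuffleAlgebra

end ShuffleAlgebra

/-! ### Leading words and Radford's theorem -/

noncomputable section LeadingWords

open ShuffleAlgebra

variable {X : Type*} [LinearOrder X]

/-- The Lyndon words occurring in a monomial, with multiplicities. -/
def monomialWords (m : Lyndon X →₀ ℕ) : Multiset (List X) := (Finsupp.toMultiset m).map Subtype.val

/-- The concatenation of the Lyndon words of a monomial in nonincreasing order. -/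
def leadingWord (m : Lyndon X →₀ ℕ) : List X := sortedConcat (monomialWords m)

theorem isLyndon_of_mem_monomialWords {m : Lyndon X →₀ ℕ} {x : List X}
    (h : x ∈ monomialWords m) : IsLyndon x := by
  obtain ⟨l, -, rfl⟩ := Multiset.mem_map.1 h
  exact l.2

theorem monomialWords_single_add (l : Lyndon X) (m : Lyndon X →₀ ℕ) :
    monomialWords (Finsupp.single l 1 + m) = l.1 ::ₘ monomialWords m := by
  simp [monomialWords]

theorem isLyndonSequence_sort (m : Lyndon X →₀ ℕ) :
    IsLyndonSequence ((monomialWords m).sort (· ≥ ·)) :=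
  ⟨fun _ hx => isLyndon_of_mem_monomialWords ((Multiset.mem_sort _).1 hx), Multiset.pairwise_sort ..⟩

theorem lyndonFactors_leadingWord (m : Lyndon X →₀ ℕ) :
    (lyndonFactors (leadingWord m) : Multiset (List X)) = monomialWords m := by
  rw [leadingWord, sortedConcat, (isLyndonSequence_sort m).lyndonFactors_flatten,
    Multiset.sort_eq]

theorem leadingWord_injective : Function.Injective (leadingWord (X := X)) := by
  intro m m' h
  have : monomialWords m = monomialWords m' := by
    rw [← lyndonFactors_leadingWord, h, lyndonFactors_leadingWord]
  exact Function.LeftInverse.injective Finsupp.toMultiset_toFinsupp (Multiset.map_injective Subtype.val_injective this)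

theorem leadingWord_surjective : Function.Surjective (leadingWord (X := X)) := by
  intro w
  obtain ⟨t, ht⟩ : ∃ t : Multiset (Lyndon X), t.map Subtype.val = lyndonFactors w := by
    have h : ∀ x ∈ (lyndonFactors w : Multiset (List X)), IsLyndon x :=
      fun x hx => (isLyndonSequence_lyndonFactors w).lyndon x (by simpa using hx)
    exact ⟨(lyndonFactors w : Multiset (List X)).pmap Subtype.mk h, by
      rw [Multiset.map_pmap, Multiset.pmap_eq_map, Multiset.map_id']⟩
  refine ⟨Multiset.toFinsupp t, ?_⟩
  rw [leadingWord, monomialWords, Multiset.toFinsupp_toMultiset, ht,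
    sortedConcat_coe (isLyndonSequence_lyndonFactors w).pairwise, flatten_lyndonFactors]

theorem monomialDegree_single_add (l : Lyndon X) (m : Lyndon X →₀ ℕ) :
    monomialDegree (Finsupp.single l 1 + m) = l.1.length + monomialDegree m := by
  simp [monomialDegree, Finsupp.weight_single]

theorem length_leadingWord (m : Lyndon X →₀ ℕ) :
    (leadingWord m).length = monomialDegree m := by
  have h : (leadingWord m).length = ((monomialWords m).map List.length).sum := by
    rw [leadingWord, sortedConcat, List.length_flatten]
    conv_rhs => rw [← Multiset.sort_eq (monomialWords m) (· ≥ ·)]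
    rfl
  rw [h]
  clear h
  induction m using Finsupp.induction_linear with
  | zero => simp [monomialWords, monomialDegree]
  | add f g hf hg =>
    rw [monomialWords, monomialDegree] at hf hg ⊢
    rw [map_add, map_add, Multiset.map_add, Multiset.map_add, Multiset.sum_add, hf, hg]
  | single l n =>
    rw [monomialWords, monomialDegree, Finsupp.toMultiset_single, Multiset.map_nsmul,
      Multiset.map_nsmul, Multiset.sum_nsmul, Finsupp.weight_single]
    simp

theorem exists_eq_single_add {m : Lyndon X →₀ ℕ} (h : m ≠ 0) :
    ∃ l m', m = Finsupp.single l 1 + m' ∧ ∀ x ∈ monomialWords m', x ≤ l.1 := by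
  obtain ⟨l, hl, hmax⟩ := m.support.exists_max_image Subtype.val (by simpa using h)
  have hle : Finsupp.single l 1 ≤ m := by
    rw [Finsupp.single_le_iff]
    exact Nat.one_le_iff_ne_zero.2 (Finsupp.mem_support_iff.1 hl)
  refine ⟨l, m - Finsupp.single l 1, (add_tsub_cancel_of_le hle).symm, fun x hx => ?_⟩
  obtain ⟨l', hl', rfl⟩ := Multiset.mem_map.1 hx
  rw [Finsupp.mem_toMultiset] at hl'
  exact hmax l' (Finsupp.support_tsub hl')

variable (X) in
/-- The algebra homomorphism sending the variable `l` to the Lyndon word `l`. -/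
def shuffleEval : MvPolynomial (Lyndon X) ℝ →ₐ[ℝ] ShuffleAlgebra X :=
  MvPolynomial.aeval fun l => ofWord l.1

theorem shuffleEval_monomial_single_add (l : Lyndon X) (m : Lyndon X →₀ ℕ) :
    shuffleEval X (MvPolynomial.monomial (Finsupp.single l 1 + m) 1) =
      ofWord l.1 * shuffleEval X (MvPolynomial.monomial m 1) := by
  rw [← mul_one (1 : ℝ), ← MvPolynomial.monomial_mul, mul_one, map_mul, ← MvPolynomial.X,
    shuffleEval, MvPolynomial.aeval_X]

/-- The shuffle product of the Lyndon words of a monomial has nonnegative coefficients, and its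
leading word is their nonincreasing concatenation. -/
theorem shuffleEval_monomial_spec (m : Lyndon X →₀ ℕ) :
    let c := toFinsupp X (shuffleEval X (MvPolynomial.monomial m 1))
    (∀ z, 0 ≤ c z) ∧ 0 < c (leadingWord m) ∧
      ∀ z, c z ≠ 0 → z.length = monomialDegree m ∧ z ≤ leadingWord m := by
  induction hn : monomialDegree m using Nat.strong_induction_on generalizing m with
  | _ n ih =>
  subst hn
  by_cases hm : m = 0
  · subst hm
    have h1 : shuffleEval X (MvPolynomial.monomial 0 1) = ofWord [] := by
      rw [MvPolynomial.monomial_zero', map_one, map_one, one_def]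
    have h2 : leadingWord (0 : Lyndon X →₀ ℕ) = [] := by
      simp [leadingWord, monomialWords, sortedConcat]
    classical
    simp only [h1, h2, toFinsupp_ofWord, monomialDegree, map_zero]
    refine ⟨fun z => ?_, by simp, fun z hz => ?_⟩
    · rw [Finsupp.single_apply]
      positivity
    · rw [Finsupp.single_apply_ne_zero] at hz
      simp [hz.1]
  · obtain ⟨l, m, rfl, hl⟩ := exists_eq_single_add hm
    have hpos := List.length_pos_iff.2 l.2.1
    rw [monomialDegree_single_add] at ih ⊢
    obtain ⟨ih1, ih2, ih3⟩ := ih _ (by omega) m rfl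
    have hlead : leadingWord (Finsupp.single l 1 + m) = l.1 ++ leadingWord m := by
      rw [leadingWord, monomialWords_single_add, sortedConcat_cons hl, leadingWord]
    rw [shuffleEval_monomial_single_add]
    refine ⟨fun z => ?_, ?_, fun z hz => ?_⟩
    · rw [ofWord_mul_apply]
      exact Finset.sum_nonneg fun u _ => mul_nonneg (ih1 u) (shuffleWords_nonneg ..)
    · rw [ofWord_mul_apply, hlead]
      refine Finset.sum_pos' (fun u _ => mul_nonneg (ih1 u) (shuffleWords_nonneg ..))
        ⟨leadingWord m, Finsupp.mem_support_iff.2 ih2.ne', ?_⟩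
      exact mul_pos ih2 (shuffleWords_append_pos _ _)
    · rw [ofWord_mul_apply] at hz
      obtain ⟨u, -, hu⟩ := Finset.exists_ne_zero_of_sum_ne_zero hz
      obtain ⟨hlen, hle⟩ := ih3 u (left_ne_zero_of_mul hu)
      have hsh := isShuffle_of_shuffleWords_ne_zero (right_ne_zero_of_mul hu)
      refine ⟨by rw [hsh.length_eq, hlen], ?_⟩
      -- Replace `u` by the leading word of `m`, whose Lyndon factors are known, at the cost of
      -- enlarging the shuffle.
      obtain ⟨z', hz', hzz'⟩ := hsh.symm.exists_le (hlen.trans (length_leadingWord m).symm) hle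
      refine hzz'.trans (hz'.le_sortedConcat.trans_eq ?_)
      have hF : lyndonFactors l.1 = [l.1] := by
        have h : IsLyndonSequence [l.1] := ⟨by simpa using l.2, by simp⟩
        simpa using h.lyndonFactors_flatten
      rw [lyndonFactors_leadingWord, hF, leadingWord, monomialWords_single_add, add_comm,
        Multiset.coe_singleton, Multiset.singleton_add]

theorem length_eq_of_shuffleEval_monomial_ne_zero {m : Lyndon X →₀ ℕ} {z : List X}
    (h : toFinsupp X (shuffleEval X (MvPolynomial.monomial m 1)) z ≠ 0) :
    z.length = monomialDegree m :=
  ((shuffleEval_monomial_spec m).2.2 z h).1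

theorem toFinsupp_shuffleEval_apply (p : MvPolynomial (Lyndon X) ℝ) (z : List X) :
    toFinsupp X (shuffleEval X p) z = ∑ m ∈ p.support,
      p.coeff m * toFinsupp X (shuffleEval X (MvPolynomial.monomial m 1)) z := by
  conv_lhs => rw [p.as_sum]
  rw [map_sum, map_sum, Finsupp.finsetSum_apply]
  refine Finset.sum_congr rfl fun m _ => ?_
  rw [← mul_one (p.coeff m), ← smul_eq_mul, ← MvPolynomial.smul_monomial, map_smul, map_smul]
  simp

/-- Among the monomials of `p` take the one with the greatest leading word; no other monomial of `p`
contributes to the coefficient at that word. -/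
theorem shuffleEval_injective : Function.Injective (shuffleEval X) := by
  rw [injective_iff_map_eq_zero]
  intro p hp
  by_contra hne
  obtain ⟨m, hm, hmax⟩ := p.support.exists_max_image leadingWord
    (by simpa [Finset.nonempty_iff_ne_empty] using hne)
  have h0 : toFinsupp X (shuffleEval X p) (leadingWord m) = 0 := by rw [hp]; rfl
  rw [toFinsupp_shuffleEval_apply, Finset.sum_eq_single_of_mem m hm] at h0
  · exact mul_ne_zero (MvPolynomial.mem_support_iff.1 hm)
      (shuffleEval_monomial_spec m).2.1.ne' h0
  · intro m' hm' hne'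
    by_contra hc
    have hle := ((shuffleEval_monomial_spec m').2.2 _ (right_ne_zero_of_mul hc)).2
    exact hne' (leadingWord_injective (le_antisymm (hmax m' hm') hle))

variable [Finite X]

/-- Triangular elimination: the image of the monomial with leading word `w` is a positive multiple
of `w` plus smaller words of the same length. The induction stays in one length, where finiteness of
the alphabet makes the order well-founded. -/
theorem ofWord_mem_map_shuffleEval (w : List X) :
    ofWord w ∈ (MvPolynomial.weightedHomogeneousSubmodule ℝ
      (fun l : Lyndon X => l.1.length) w.length).map (shuffleEval X).toLinearMap := by
  obtain ⟨n, hn⟩ : ∃ n, w.length = n := ⟨_, rfl⟩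
  have hwf : {w : List X | w.length = n}.WellFoundedOn (· < ·) :=
    (List.finite_length_eq X n).wellFoundedOn
  rw [hn]
  refine hwf.induction (P := fun w => ofWord w ∈ _) hn fun w hw ih => ?_
  set S := (MvPolynomial.weightedHomogeneousSubmodule ℝ
      (fun l : Lyndon X => l.1.length) n).map (shuffleEval X).toLinearMap
  obtain ⟨m, rfl⟩ := leadingWord_surjective w
  have hdeg : monomialDegree m = n := (length_leadingWord m).symm.trans hw
  obtain ⟨-, hpos, hsupp⟩ := shuffleEval_monomial_spec m
  set q := shuffleEval X (MvPolynomial.monomial m 1)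
  have hq : q ∈ S := Submodule.mem_map_of_mem
    (MvPolynomial.isWeightedHomogeneous_monomial _ _ _ hdeg)
  have hsum := eq_sum q
  rw [← Finset.add_sum_erase _ _ (Finsupp.mem_support_iff.2 hpos.ne')] at hsum
  have hrest : ∑ u ∈ (toFinsupp X q).support.erase (leadingWord m),
      toFinsupp X q u • ofWord u ∈ S := by
    refine Submodule.sum_mem _ fun u hu => Submodule.smul_mem _ _ ?_
    obtain ⟨hne, hu⟩ := Finset.mem_erase.1 hu
    obtain ⟨h1, h2⟩ := hsupp u (Finsupp.mem_support_iff.1 hu)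
    exact ih u (h1.trans hdeg) (lt_of_le_of_ne h2 hne)
  have := (Submodule.add_mem_iff_left S hrest).1 (hsum ▸ hq)
  exact (Submodule.smul_mem_iff S hpos.ne').1 this

theorem shuffleEval_surjective : Function.Surjective (shuffleEval X) := by
  intro p
  have h : p ∈ LinearMap.range (shuffleEval X).toLinearMap := by
    rw [eq_sum p]
    exact Submodule.sum_mem _ fun u _ => Submodule.smul_mem _ _
      (LinearMap.map_le_range (ofWord_mem_map_shuffleEval u))
  exact h

variable (X) in
/-- Radford's theorem: the shuffle algebra is the polynomial algebra in the Lyndon words. -/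
def shuffleEquiv : MvPolynomial (Lyndon X) ℝ ≃ₐ[ℝ] ShuffleAlgebra X :=
  AlgEquiv.ofBijective (shuffleEval X) ⟨shuffleEval_injective, shuffleEval_surjective⟩

theorem shuffleEquiv_apply (p : MvPolynomial (Lyndon X) ℝ) :
    shuffleEquiv X p = shuffleEval X p := rfl

theorem isWeightedHomogeneous_shuffleEquiv_symm_ofWord (w : List X) :
    ((shuffleEquiv X).symm (ofWord w)).IsWeightedHomogeneous
      (fun l : Lyndon X => l.1.length) w.length := by
  obtain ⟨p, hp, hpw⟩ := ofWord_mem_map_shuffleEval w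
  have : (shuffleEquiv X).symm (ofWord w) = p := by
    rw [AlgEquiv.symm_apply_eq]
    exact hpw.symm
  rw [this]
  exact hp

end LeadingWords

/-! ### Extension to series, degree by degree -/

noncomputable section Grading

open ShuffleAlgebra

theorem finsum_subtype_eq_sum {α M : Type*} [AddCommMonoid M] {p : α → Prop} (g : α → M)
    (s : Finset α) (h : ∀ a, g a ≠ 0 → p a ∧ a ∈ s) :
    ∑ᶠ a : {a // p a}, g a = ∑ a ∈ s, g a := by
  rw [finsum_subtype_eq_finsum_cond]
  have h1 : ∀ a, (∑ᶠ _ : p a, g a) = g a := by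
    intro a
    by_cases hp : p a
    · simp [hp]
    · have : g a = 0 := by
        by_contra hc
        exact hp (h a hc).1
      simp [this]
  simp_rw [h1]
  exact finsum_eq_sum_of_support_subset _ fun a ha => (h a ha).2

section Words

variable {X : Type*} [Finite X]

variable (X) in
/-- The words of length `k`. -/
def wordsOfLength (k : ℕ) : Finset (List X) := (List.finite_length_eq X k).toFinset

@[simp]
theorem mem_wordsOfLength {k : ℕ} {w : List X} : w ∈ wordsOfLength X k ↔ w.length = k := by
  simp [wordsOfLength]

variable (X) in
/-- The part of length `k` of a series in the letters, as an element of the shuffle algebra. -/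
def wordTrunc (k : ℕ) : (List X → ℝ) →ₗ[ℝ] ShuffleAlgebra X :=
  ∑ w ∈ wordsOfLength X k, (LinearMap.proj w).smulRight (ofWord w)

theorem wordTrunc_apply (k : ℕ) (c : List X → ℝ) :
    wordTrunc X k c = ∑ w ∈ wordsOfLength X k, c w • ofWord w := by
  simp [wordTrunc]

theorem toFinsupp_wordTrunc (k : ℕ) (c : List X → ℝ) (w : List X) :
    toFinsupp X (wordTrunc X k c) w = if w.length = k then c w else 0 := by
  classical
  simp [wordTrunc_apply, Finsupp.single_apply]

end Words

variable {X : Type*} [LinearOrder X]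

theorem finite_setOf_monomialDegree_eq [Finite X] (k : ℕ) :
    {m : Lyndon X →₀ ℕ | monomialDegree m = k}.Finite := by
  refine ((List.finite_length_eq X k).preimage leadingWord_injective.injOn).subset fun m hm => ?_
  exact (length_leadingWord m).trans hm

variable (X) [Finite X]

/-- The Lyndon monomials of degree `k`. -/
def monomialsOfDegree (k : ℕ) : Finset (Lyndon X →₀ ℕ) :=
  (finite_setOf_monomialDegree_eq k).toFinset

variable {X}

@[simp]
theorem mem_monomialsOfDegree {k : ℕ} {m : Lyndon X →₀ ℕ} :
    m ∈ monomialsOfDegree X k ↔ monomialDegree m = k := by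
  simp [monomialsOfDegree]

theorem coeff_shuffleEquiv_symm_ofWord {m : Lyndon X →₀ ℕ} {w : List X}
    (h : monomialDegree m ≠ w.length) :
    ((shuffleEquiv X).symm (ofWord w)).coeff m = 0 :=
  (isWeightedHomogeneous_shuffleEquiv_symm_ofWord w).coeff_eq_zero m h

theorem coeff_zero_shuffleEquiv_symm (p : ShuffleAlgebra X) :
    ((shuffleEquiv X).symm p).coeff 0 = toFinsupp X p [] := by
  refine LinearMap.congr_fun
    (f := MvPolynomial.lcoeff ℝ 0 ∘ₗ (shuffleEquiv X).symm.toLinearMap)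
    (g := Finsupp.lapply [] ∘ₗ (toFinsupp X).toLinearMap) (hom_ext fun w => ?_) p
  by_cases hw : w = []
  · subst hw
    have h : (shuffleEquiv X).symm (ofWord []) = 1 := map_one _
    simp [h]
  · have h : monomialDegree (0 : Lyndon X →₀ ℕ) ≠ w.length := by
      simpa [monomialDegree, eq_comm] using hw
    simpa [hw] using coeff_shuffleEquiv_symm_ofWord h

variable (X) in
/-- The part of degree `k` of a series in the Lyndon words, as a polynomial. -/
def monomialTrunc (k : ℕ) : MvPowerSeries (Lyndon X) ℝ →ₗ[ℝ] MvPolynomial (Lyndon X) ℝ :=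
  ∑ m ∈ monomialsOfDegree X k, MvPolynomial.monomial m ∘ₗ MvPowerSeries.coeff m

theorem monomialTrunc_apply (k : ℕ) (f : MvPowerSeries (Lyndon X) ℝ) :
    monomialTrunc X k f =
      ∑ m ∈ monomialsOfDegree X k, MvPolynomial.monomial m (MvPowerSeries.coeff m f) := by
  simp [monomialTrunc]

theorem coeff_monomialTrunc (k : ℕ) (f : MvPowerSeries (Lyndon X) ℝ) (m : Lyndon X →₀ ℕ) :
    (monomialTrunc X k f).coeff m = if monomialDegree m = k then MvPowerSeries.coeff m f else 0 := by
  classical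
  simp [monomialTrunc_apply, MvPolynomial.coeff_sum, MvPolynomial.coeff_monomial]

theorem coeff_shuffleEquiv_symm_wordTrunc (k : ℕ) (c : List X → ℝ) (m : Lyndon X →₀ ℕ) :
    ((shuffleEquiv X).symm (wordTrunc X k c)).coeff m =
      ∑ w ∈ wordsOfLength X k, c w * ((shuffleEquiv X).symm (ofWord w)).coeff m := by
  simp [wordTrunc_apply, MvPolynomial.coeff_sum]

theorem shuffleEquiv_monomialTrunc_apply (k : ℕ) (f : MvPowerSeries (Lyndon X) ℝ) (w : List X) :
    toFinsupp X (shuffleEquiv X (monomialTrunc X k f)) w =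
      ∑ m ∈ monomialsOfDegree X k, MvPowerSeries.coeff m f *
        toFinsupp X (shuffleEquiv X (MvPolynomial.monomial m 1)) w := by
  rw [monomialTrunc_apply, map_sum, map_sum, Finsupp.finsetSum_apply]
  refine Finset.sum_congr rfl fun m _ => ?_
  rw [← mul_one (MvPowerSeries.coeff m f), ← smul_eq_mul, ← MvPolynomial.smul_monomial, map_smul,
    map_smul]
  simp

variable (X) in
/-- The extension of the inverse of `shuffleEquiv` to series. -/
def seriesHom : (List X → ℝ) →ₗ[ℝ] MvPowerSeries (Lyndon X) ℝ where
  toFun c m := ((shuffleEquiv X).symm (wordTrunc X (monomialDegree m) c)).coeff m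
  map_add' c d := by
    ext m
    simp only [map_add, MvPolynomial.coeff_add]
    rfl
  map_smul' r c := by
    ext m
    simp only [map_smul, MvPolynomial.coeff_smul]
    rfl

variable (X) in
/-- The extension of `shuffleEquiv` to series. -/
def seriesInv : MvPowerSeries (Lyndon X) ℝ →ₗ[ℝ] (List X → ℝ) where
  toFun f w := toFinsupp X (shuffleEquiv X (monomialTrunc X w.length f)) w
  map_add' c d := by
    ext m
    simp only [map_add, Finsupp.add_apply, Pi.add_apply]
  map_smul' r c := by
    ext m
    simp only [map_smul, Finsupp.smul_apply, Pi.smul_apply, RingHom.id_apply]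

theorem coeff_seriesHom (c : List X → ℝ) (m : Lyndon X →₀ ℕ) :
    MvPowerSeries.coeff m (seriesHom X c) =
      ((shuffleEquiv X).symm (wordTrunc X (monomialDegree m) c)).coeff m := rfl

theorem seriesInv_apply (f : MvPowerSeries (Lyndon X) ℝ) (w : List X) :
    seriesInv X f w = toFinsupp X (shuffleEquiv X (monomialTrunc X w.length f)) w := rfl

/-- Block diagonality: truncation commutes with the map. With `wordTrunc_seriesInv`, this reduces
invertibility on series to invertibility on polynomials. -/
theorem monomialTrunc_seriesHom (k : ℕ) (c : List X → ℝ) :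
    monomialTrunc X k (seriesHom X c) = (shuffleEquiv X).symm (wordTrunc X k c) := by
  ext m
  rw [coeff_monomialTrunc, coeff_seriesHom]
  split_ifs with h
  · rw [h]
  · rw [coeff_shuffleEquiv_symm_wordTrunc]
    refine (Finset.sum_eq_zero fun w hw => ?_).symm
    rw [mem_wordsOfLength] at hw
    rw [coeff_shuffleEquiv_symm_ofWord (hw ▸ h), mul_zero]

theorem wordTrunc_seriesInv (k : ℕ) (f : MvPowerSeries (Lyndon X) ℝ) :
    wordTrunc X k (seriesInv X f) = shuffleEquiv X (monomialTrunc X k f) := by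
  apply (toFinsupp X).injective
  ext w
  rw [toFinsupp_wordTrunc, seriesInv_apply]
  split_ifs with h
  · rw [h]
  · rw [shuffleEquiv_monomialTrunc_apply]
    refine (Finset.sum_eq_zero fun m hm => ?_).symm
    rw [mem_monomialsOfDegree] at hm
    refine mul_eq_zero_of_right _ ?_
    by_contra hc
    exact h ((length_eq_of_shuffleEval_monomial_ne_zero hc).trans hm)

variable (X) in
/-- The extension of the inverse of `shuffleEquiv` to an isomorphism between series. -/
def seriesEquiv : (List X → ℝ) ≃ₗ[ℝ] MvPowerSeries (Lyndon X) ℝ :=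
  LinearEquiv.ofLinearMap (seriesHom X) (seriesInv X)
    (by
      ext1 f
      ext m
      rw [LinearMap.comp_apply, coeff_seriesHom, wordTrunc_seriesInv, AlgEquiv.symm_apply_apply,
        coeff_monomialTrunc, if_pos rfl, LinearMap.id_apply])
    (by
      refine LinearMap.ext fun c => funext fun w => ?_
      rw [LinearMap.comp_apply, seriesInv_apply, monomialTrunc_seriesHom,
        AlgEquiv.apply_symm_apply, toFinsupp_wordTrunc, if_pos rfl, LinearMap.id_apply])

theorem coeff_zero_seriesHom (c : List X → ℝ) :
    MvPowerSeries.coeff 0 (seriesHom X c) = c [] := by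
  rw [coeff_seriesHom, coeff_zero_shuffleEquiv_symm, toFinsupp_wordTrunc, if_pos]
  simp [monomialDegree]

theorem coeff_seriesHom_toFinsupp (p : ShuffleAlgebra X) (m : Lyndon X →₀ ℕ) :
    MvPowerSeries.coeff m (seriesHom X (toFinsupp X p)) = ((shuffleEquiv X).symm p).coeff m := by
  refine LinearMap.congr_fun
    (f := MvPowerSeries.coeff m ∘ₗ seriesHom X ∘ₗ Finsupp.lcoeFun ∘ₗ (toFinsupp X).toLinearMap)
    (g := MvPolynomial.lcoeff ℝ m ∘ₗ (shuffleEquiv X).symm.toLinearMap) (hom_ext fun w => ?_) p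
  have key : ((shuffleEquiv X).symm (wordTrunc X (monomialDegree m) (toFinsupp X (ofWord w)))).coeff
      m = ((shuffleEquiv X).symm (ofWord w)).coeff m := by
    by_cases h : monomialDegree m = w.length
    · congr 2
      apply (toFinsupp X).injective
      ext v
      rw [toFinsupp_wordTrunc, h]
      split_ifs with hv
      · rfl
      · rw [toFinsupp_ofWord, Finsupp.single_eq_of_ne]
        rintro rfl
        exact hv rfl
    · rw [coeff_shuffleEquiv_symm_ofWord h, coeff_shuffleEquiv_symm_wordTrunc]
      refine Finset.sum_eq_zero fun v hv => ?_
      rw [mem_wordsOfLength] at hv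
      rw [toFinsupp_ofWord, Finsupp.single_eq_of_ne, zero_mul]
      rintro rfl
      exact h hv.symm
  exact key

theorem map_polyEquiv_properPoly :
    (properPoly X).map ((toFinsupp X).symm ≪≫ₗ (shuffleEquiv X).symm.toLinearEquiv :
      (List X →₀ ℝ) →ₗ[ℝ] MvPolynomial (Lyndon X) ℝ) = lyndonPoly X := by
  rw [← Submodule.map_comap_eq_of_surjective ((toFinsupp X).symm ≪≫ₗ
    (shuffleEquiv X).symm.toLinearEquiv).surjective (lyndonPoly X)]
  congr 1
  ext p
  change p [] = 0 ↔ ((shuffleEquiv X).symm ((toFinsupp X).symm p)).coeff 0 = 0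
  rw [coeff_zero_shuffleEquiv_symm, LinearEquiv.apply_symm_apply]

theorem map_seriesEquiv_properSeries :
    (properSeries X).map (seriesEquiv X : (List X → ℝ) →ₗ[ℝ] MvPowerSeries (Lyndon X) ℝ) =
      lyndonSeries X := by
  rw [← Submodule.map_comap_eq_of_surjective (seriesEquiv X).surjective (lyndonSeries X)]
  congr 1
  ext c
  change c [] = 0 ↔ MvPowerSeries.coeff 0 (seriesHom X c) = 0
  rw [coeff_zero_seriesHom]

variable (X) in
/-- The isomorphism from proper polynomials to polynomials in the Lyndon words. -/
def lyndonEquiv : properPoly X ≃ₗ[ℝ] lyndonPoly X :=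
  LinearEquiv.ofSubmodules ((toFinsupp X).symm ≪≫ₗ (shuffleEquiv X).symm.toLinearEquiv) _ _
    map_polyEquiv_properPoly

variable (X) in
/-- The isomorphism from proper series to series in the Lyndon words. -/
def lyndonSeriesEquiv : properSeries X ≃ₗ[ℝ] lyndonSeries X :=
  LinearEquiv.ofSubmodules (seriesEquiv X) _ _ map_seriesEquiv_properSeries

theorem coe_lyndonEquiv_symm_mono (m : LyndonMonomial X) :
    ((lyndonEquiv X).symm (mono m) : List X →₀ ℝ) =
      toFinsupp X (shuffleEquiv X (MvPolynomial.monomial m.1 1)) := rfl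

theorem coe_lyndonSeriesEquiv (c : properSeries X) :
    (lyndonSeriesEquiv X c : MvPowerSeries (Lyndon X) ℝ) = seriesHom X c.1 := rfl

theorem coe_lyndonSeriesEquiv_symm (f : lyndonSeries X) :
    ((lyndonSeriesEquiv X).symm f : List X → ℝ) = seriesInv X f.1 := rfl

theorem isLyndonMap_lyndonEquiv :
    IsLyndonMap (lyndonEquiv X : properPoly X →ₗ[ℝ] lyndonPoly X) where
  map_shuffle u v := by
    have h := map_mul (shuffleEquiv X).symm (ofWord u.1) (ofWord v.1)
    rw [ofWord_mul_ofWord] at h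
    exact h
  map_lyndon l := by
    change (shuffleEquiv X).symm (ofWord l.1) = _
    rw [AlgEquiv.symm_apply_eq, shuffleEquiv_apply, shuffleEval, MvPolynomial.aeval_X]

end Grading

/-! ### Uniqueness of the map -/

noncomputable section Uniqueness

open ShuffleAlgebra

section ProperPart

variable {X : Type*}

variable (X) in
/-- The projection of the noncommutative polynomials onto the proper ones. -/
def properPart : (List X →₀ ℝ) →ₗ[ℝ] properPoly X :=
  LinearMap.codRestrict (properPoly X)
    (LinearMap.id - Finsupp.lsingle [] ∘ₗ Finsupp.lapply []) fun p => by simp [properPoly]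

theorem properPart_coe (p : properPoly X) : properPart X p = p := by
  have h : p.1 [] = 0 := p.2
  apply Subtype.ext
  change p.1 - Finsupp.single [] (p.1 []) = p.1
  rw [h, Finsupp.single_zero, sub_zero]

theorem properPart_single_nil : properPart X (Finsupp.single [] 1) = 0 := by
  apply Subtype.ext
  change Finsupp.single [] 1 - Finsupp.single [] ((Finsupp.single [] (1 : ℝ)) []) = 0
  rw [Finsupp.single_eq_same, sub_self]

end ProperPart

variable {X : Type*} [LinearOrder X]

/-- The unital extension of a linear map between proper polynomials. -/
def unitalExtension (T : properPoly X →ₗ[ℝ] lyndonPoly X) :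
    ShuffleAlgebra X →ₗ[ℝ] MvPolynomial (Lyndon X) ℝ :=
  ((Finsupp.lapply []).smulRight (1 : MvPolynomial (Lyndon X) ℝ) +
    (lyndonPoly X).subtype ∘ₗ T ∘ₗ properPart X) ∘ₗ (toFinsupp X).toLinearMap

theorem unitalExtension_coe (T : properPoly X →ₗ[ℝ] lyndonPoly X) (p : properPoly X) :
    unitalExtension T ((toFinsupp X).symm p) = T p := by
  have h : p.1 [] = 0 := p.2
  simp [unitalExtension, properPart_coe, h]

theorem unitalExtension_one (T : properPoly X →ₗ[ℝ] lyndonPoly X) :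
    unitalExtension T 1 = 1 := by
  simp [unitalExtension, one_def, properPart_single_nil]

/-- By bilinearity it suffices to check words; the defining property covers nonempty ones, and the
empty word is the unit. -/
theorem IsLyndonMap.unitalExtension_mul {T : properPoly X →ₗ[ℝ] lyndonPoly X}
    (hT : IsLyndonMap T) (p q : ShuffleAlgebra X) :
    unitalExtension T (p * q) = unitalExtension T p * unitalExtension T q := by
  refine (LinearMap.map_mul_iff (unitalExtension T)).2
    (hom_ext fun u => hom_ext fun v => ?_) p q
  change unitalExtension T (ofWord u * ofWord v) =
    unitalExtension T (ofWord u) * unitalExtension T (ofWord v)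
  by_cases hu : u = []
  · rw [hu, ← one_def, one_mul, unitalExtension_one, one_mul]
  by_cases hv : v = []
  · rw [hv, ← one_def, mul_one, unitalExtension_one, mul_one]
  rw [ofWord_mul_ofWord]
  have h := hT.map_shuffle ⟨u, hu⟩ ⟨v, hv⟩
  rw [← unitalExtension_coe, ← unitalExtension_coe, ← unitalExtension_coe] at h
  exact h

/-- The composite is an algebra endomorphism of the polynomial ring that fixes every variable. -/
theorem IsLyndonMap.unitalExtension_shuffleEval {T : properPoly X →ₗ[ℝ] lyndonPoly X}
    (hT : IsLyndonMap T) (p : MvPolynomial (Lyndon X) ℝ) :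
    unitalExtension T (shuffleEval X p) = p := by
  refine AlgHom.congr_fun (φ₁ := (AlgHom.ofLinearMap (unitalExtension T) (unitalExtension_one T)
    hT.unitalExtension_mul).comp (shuffleEval X)) (φ₂ := AlgHom.id ℝ _)
    (MvPolynomial.algHom_ext fun l => ?_) p
  rw [AlgHom.comp_apply, shuffleEval, MvPolynomial.aeval_X, AlgHom.id_apply, ← hT.map_lyndon l,
    ← unitalExtension_coe]
  rfl

theorem IsLyndonMap.eq_lyndonEquiv [Finite X] {T : properPoly X →ₗ[ℝ] lyndonPoly X}
    (hT : IsLyndonMap T) : T = lyndonEquiv X := by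
  ext1 p
  apply Subtype.ext
  rw [← unitalExtension_coe]
  change _ = (shuffleEquiv X).symm ((toFinsupp X).symm p.1)
  conv_rhs => rw [← hT.unitalExtension_shuffleEval ((shuffleEquiv X).symm _)]
  rw [← shuffleEquiv_apply, AlgEquiv.apply_symm_apply]

end Uniqueness

/-! ### Coefficient formulas and gradedness -/

noncomputable section Graded

open ShuffleAlgebra

theorem seriesPart_apply {X : Type*} (k : ℕ) (c : properSeries X) (w : List X) :
    (seriesPart k c).1 w = if w.length = k then c.1 w else 0 := rfl

theorem mem_seriesComponent_iff {X : Type*} {k : ℕ} {c : properSeries X} :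
    c ∈ seriesComponent X k ↔ seriesPart k c = c := by
  refine ⟨fun h => Subtype.ext (funext fun w => ?_), fun h w hw => ?_⟩
  · change (if w.length = k then c.1 w else 0) = c.1 w
    split_ifs with hw
    · rfl
    · exact (h w hw).symm
  · rw [← h, seriesPart_apply, if_neg hw]

theorem mem_lyndonComponent_iff {X : Type*} [LinearOrder X] {k : ℕ} {f : lyndonSeries X} :
    f ∈ lyndonComponent X k ↔ lyndonPart k f = f :=
  MvPowerSeries.isWeightedHomogeneous_iff_eq_weightedHomogeneousComponent.trans
    ⟨fun h => Subtype.ext h.symm, fun h => (congrArg Subtype.val h).symm⟩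

variable {X : Type*} [LinearOrder X] [Finite X]

theorem coeff_lyndonSeriesEquiv (c : properSeries X) (m : Lyndon X →₀ ℕ) :
    MvPowerSeries.coeff m (lyndonSeriesEquiv X c).1 =
      ∑ w ∈ wordsOfLength X (monomialDegree m),
        c.1 w * ((shuffleEquiv X).symm (ofWord w)).coeff m := by
  rw [coe_lyndonSeriesEquiv, coeff_seriesHom, coeff_shuffleEquiv_symm_wordTrunc]

theorem coeff_lyndonSeriesEquiv_eq_finsum (c : properSeries X) (m : LyndonMonomial X) :
    MvPowerSeries.coeff m.1 (lyndonSeriesEquiv X c).1 =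
      ∑ᶠ w : NEWord X, c.1 w.1 * MvPolynomial.coeff m.1 (lyndonEquiv X (word w)).1 := by
  rw [coeff_lyndonSeriesEquiv]
  refine (finsum_subtype_eq_sum (p := fun w : List X => w ≠ [])
    (fun w => c.1 w * ((shuffleEquiv X).symm (ofWord w)).coeff m.1) _ fun w hw => ⟨?_, ?_⟩).symm
  -- Properness of `c` removes the empty word from the sum.
  · rintro rfl
    exact left_ne_zero_of_mul hw c.2
  · rw [mem_wordsOfLength]
    by_contra hc
    exact right_ne_zero_of_mul hw (coeff_shuffleEquiv_symm_ofWord (Ne.symm hc))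

theorem lyndonSeriesEquiv_symm_apply_eq_finsum (f : lyndonSeries X) (w : NEWord X) :
    ((lyndonSeriesEquiv X).symm f).1 w.1 =
      ∑ᶠ m : LyndonMonomial X,
        MvPowerSeries.coeff m.1 f.1 * ((lyndonEquiv X).symm (mono m)).1 w.1 := by
  rw [coe_lyndonSeriesEquiv_symm, seriesInv_apply, shuffleEquiv_monomialTrunc_apply]
  refine (finsum_subtype_eq_sum (p := fun m : Lyndon X →₀ ℕ => m ≠ 0)
    (fun m => MvPowerSeries.coeff m f.1 *
      toFinsupp X (shuffleEquiv X (MvPolynomial.monomial m 1)) w.1) _ fun m hm => ⟨?_, ?_⟩).symm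
  · rintro rfl
    exact left_ne_zero_of_mul hm f.2
  · rw [mem_monomialsOfDegree]
    exact (length_eq_of_shuffleEval_monomial_ne_zero (right_ne_zero_of_mul hm)).symm

theorem lyndonSeriesEquiv_seriesPart (k : ℕ) (c : properSeries X) :
    lyndonSeriesEquiv X (seriesPart k c) = lyndonPart k (lyndonSeriesEquiv X c) := by
  apply Subtype.ext
  ext m
  change _ = MvPowerSeries.coeff m (MvPowerSeries.weightedHomogeneousComponent
    (fun l : Lyndon X => l.1.length) k (lyndonSeriesEquiv X c).1)
  rw [MvPowerSeries.coeff_weightedHomogeneousComponent]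
  change _ = if monomialDegree m = k then _ else _
  rw [coeff_lyndonSeriesEquiv, coeff_lyndonSeriesEquiv]
  split_ifs with h
  · refine Finset.sum_congr rfl fun w hw => ?_
    rw [seriesPart_apply, if_pos ((mem_wordsOfLength.1 hw).trans h)]
  · refine Finset.sum_eq_zero fun w hw => ?_
    rw [seriesPart_apply, if_neg (fun hc => h ((mem_wordsOfLength.1 hw).symm.trans hc)), zero_mul]

/-- Each component consists of the fixed points of its projection, and the isomorphism intertwines
the two projections. -/
theorem map_lyndonSeriesEquiv_seriesComponent (k : ℕ) :
    (seriesComponent X k).map (lyndonSeriesEquiv X : properSeries X →ₗ[ℝ] lyndonSeries X) =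
      lyndonComponent X k := by
  ext f
  obtain ⟨c, rfl⟩ := (lyndonSeriesEquiv X).surjective f
  rw [mem_lyndonComponent_iff, ← lyndonSeriesEquiv_seriesPart,
    (lyndonSeriesEquiv X).injective.eq_iff, ← mem_seriesComponent_iff]
  exact (Submodule.mem_map_equiv _).trans (by rw [LinearEquiv.symm_apply_apply])

theorem lyndonSeriesEquiv_polyToSeries (p : properPoly X) :
    lyndonSeriesEquiv X (polyToSeries p) = lyndonPolyToSeries (lyndonEquiv X p) := by
  apply Subtype.ext
  ext m
  exact (coeff_seriesHom_toFinsupp ((toFinsupp X).symm p.1) m).trans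
    (MvPolynomial.coeff_coe _ _).symm

end Graded

end LyndonTransduction

theorem mainTheorem4 {X : Type*} [LinearOrder X] [Finite X] [Nonempty X] :
    -- the map on proper polynomials, uniquely determined by its defining properties
    ∃ L₀ : properPoly X ≃ₗ[ℝ] lyndonPoly X,
      IsLyndonMap (L₀ : properPoly X →ₗ[ℝ] lyndonPoly X) ∧
      (∀ T : properPoly X →ₗ[ℝ] lyndonPoly X, IsLyndonMap T → T = L₀) ∧
      -- it and its inverse are block diagonal by degree and locally finite
      (∀ (m : LyndonMonomial X) (w : NEWord X), monomialDegree m.1 ≠ w.1.length →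
        MvPolynomial.coeff m.1 (L₀ (word w)).1 = 0 ∧ (L₀.symm (mono m)).1 w.1 = 0) ∧
      (∀ m : LyndonMonomial X,
        {w : NEWord X | MvPolynomial.coeff m.1 (L₀ (word w)).1 ≠ 0}.Finite) ∧
      (∀ w : NEWord X, {m : LyndonMonomial X | (L₀.symm (mono m)).1 w.1 ≠ 0}.Finite) ∧
      -- the extension to series is a linear isomorphism
      ∃ L : properSeries X ≃ₗ[ℝ] lyndonSeries X,
        (∀ p : properPoly X, L (polyToSeries p) = lyndonPolyToSeries (L₀ p)) ∧
        (∀ (c : properSeries X) (m : LyndonMonomial X),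
          MvPowerSeries.coeff m.1 (L c).1 =
            ∑ᶠ w : NEWord X, c.1 w.1 * MvPolynomial.coeff m.1 (L₀ (word w)).1) ∧
        (∀ (f : lyndonSeries X) (w : NEWord X),
          (L.symm f).1 w.1 =
            ∑ᶠ m : LyndonMonomial X,
              MvPowerSeries.coeff m.1 f.1 * (L₀.symm (mono m)).1 w.1) ∧
        -- which is graded
        (∀ k : ℕ, 0 < k →
          (seriesComponent X k).map (L : properSeries X →ₗ[ℝ] lyndonSeries X) =
            lyndonComponent X k) ∧
        (∀ (k : ℕ) (c : properSeries X), L (seriesPart k c) = lyndonPart k (L c)) := by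
  refine ⟨lyndonEquiv X, isLyndonMap_lyndonEquiv, fun T hT => hT.eq_lyndonEquiv,
    fun m w h => ⟨coeff_shuffleEquiv_symm_ofWord h, ?_⟩, fun m => ?_, fun w => ?_,
    lyndonSeriesEquiv X, lyndonSeriesEquiv_polyToSeries, coeff_lyndonSeriesEquiv_eq_finsum,
    lyndonSeriesEquiv_symm_apply_eq_finsum, fun k _ => map_lyndonSeriesEquiv_seriesComponent k,
    lyndonSeriesEquiv_seriesPart⟩
  · rw [coe_lyndonEquiv_symm_mono]
    by_contra hc
    exact h (length_eq_of_shuffleEval_monomial_ne_zero hc).symm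
  · refine ((List.finite_length_eq X (monomialDegree m.1)).preimage
      Subtype.val_injective.injOn).subset fun w hw => ?_
    by_contra hc
    exact hw (coeff_shuffleEquiv_symm_ofWord (Ne.symm hc))
  · refine ((finite_setOf_monomialDegree_eq w.1.length).preimage
      Subtype.val_injective.injOn).subset fun m hm => ?_
    exact (length_eq_of_shuffleEval_monomial_ne_zero hm).symm
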